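/- Let $T$ be the Hardy operator, $Tf(x)=\frac1x\int_0^x f(t)\,dt$ for $x>0$, and for an integer $m\ge 1$ let $T\otimes\cdots\otimes T$ be its $m$-fold tensor product, acting on functions on $\Lambda_m=[0,\infty)^m$: $$[(T\otimes\cdots\otimes T)H](x_1,\dots,x_m)=\frac{1}{x_1\cdots x_m}\int_0^{x_1}\!\!\cdots\int_0^{x_m}H(t_1,\dots,t_m)\,dt_m\cdots dt_1,\qquad x_1,\dots,x_m>0.$$ Theorem. Let $1<p\le q<\infty$ and $\gamma=\frac mp-\frac1q$. There is a finite constant $C$, depending only on $m$, $p$ and $q$, such that for every complex-valued $H\in L^p(\Lambda_m)$ the function $(T\otimes\cdots\otimes T)H$ is well defined ($H$ is integrable on every box $\prod_i(0,x_i]$), the weighted diagonal trace $$\psi(x)=x^{\gamma}\,[(T\otimes\cdots\otimes T)H](x,\dots,x),\qquad x>0,$$ belongs to $L^q(0,\infty)$, and $$\|\psi\|_{L^q(0,\infty)}\le C\,\|H\|_{L^p(\Lambda_m)}.$$ -/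

import Mathlib

open MeasureTheory Set
open scoped ENNReal NNReal

noncomputable section

/-- The closed orthant `[0, ∞)^m` in `ℝ^m`. -/
def orthant (m : ℕ) : Set (Fin m → ℝ) := {x | ∀ i, 0 ≤ x i}

/-- The Hardy operator `T f (x) = (1 / x) ∫_0^x f(t) dt`, for `x > 0`. -/
def hardy (f : ℝ → ℂ) (x : ℝ) : ℂ := x⁻¹ • ∫ t in Ioc 0 x, f t

/-- The box `(0, x_1] × ⋯ × (0, x_m]`. -/
def box {m : ℕ} (x : Fin m → ℝ) : Set (Fin m → ℝ) := Set.univ.pi fun i => Ioc 0 (x i)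

/-- The tensor product `T ⊗ ⋯ ⊗ T` of `m` copies of the Hardy operator, acting on functions on
`[0, ∞)^m`: the integral operator whose kernel is the product of the kernels of `T`, that is
`(x_1 ⋯ x_m)⁻¹ ∫_0^{x_1} ⋯ ∫_0^{x_m} H(t) dt` at a point with positive coordinates. -/
def tensorHardy {m : ℕ} (H : (Fin m → ℝ) → ℂ) (x : Fin m → ℝ) : ℂ :=
  (∏ i, x i)⁻¹ • ∫ t in box x, H t

/-- The defining property of the tensor product: on product functions,
`(T ⊗ ⋯ ⊗ T)(f_1 ⊗ ⋯ ⊗ f_m) = T f_1 ⊗ ⋯ ⊗ T f_m`. -/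
theorem tensorHardy_prod {m : ℕ} (f : Fin m → ℝ → ℂ) (x : Fin m → ℝ) :
    tensorHardy (fun t => ∏ i, f i (t i)) x = ∏ i, hardy (f i) (x i) := by
  have h : ∫ t in box x, ∏ i, f i (t i) = ∏ i, ∫ t in Ioc 0 (x i), f i t := by
    rw [box, volume_pi, Measure.restrict_pi_pi]
    exact integral_fintype_prod_eq_prod (fun i => f i)
  simp only [tensorHardy, hardy, h, Complex.real_smul, Finset.prod_mul_distrib]
  push_cast
  rw [Finset.prod_inv_distrib]

/-- The weighted diagonal trace `ψ(x) = x^γ [(T ⊗ ⋯ ⊗ T) H](x, …, x)`, for `x > 0`. -/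
def diagTrace {m : ℕ} (γ : ℝ) (H : (Fin m → ℝ) → ℂ) (x : ℝ) : ℂ :=
  (x ^ γ : ℝ) • tensorHardy H (fun _ => x)

end

/-! Put h = |H|, let F(x) be its integral over the box of side x, and A the integral of h^p. Split
F^q = F^p · F^(q-p). Plain Hölder bounds F^(q-p) by a power of A times a power of x
(`lintegral_box_rpow_le`). Using it for F^p as well would leave x^(-1), which diverges
logarithmically. So F^p is treated by Hölder with weight ∏ t_i^(-1/2)
(`lintegral_box_rpow_le_weighted`), which keeps the t-integral and gains decay in x. Tonelli then
finishes (`lintegral_Ioi_rpow_mul_lintegral_box_le`). -/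

/-- Hölder for the factorization h = (h u^(-(p-1)/p)) · u^((p-1)/p), valid where u is neither 0 nor
∞. -/
theorem lintegral_rpow_le_weighted {α : Type*} [MeasurableSpace α] {μ : Measure α} {p : ℝ}
    (hp : 1 < p) {h u : α → ℝ≥0∞} (hh : AEMeasurable h μ) (hu : AEMeasurable u μ)
    (hu0 : ∀ᵐ t ∂μ, u t ≠ 0) (hu1 : ∀ᵐ t ∂μ, u t ≠ ∞) :
    (∫⁻ t, h t ∂μ) ^ p ≤
      (∫⁻ t, h t ^ p * u t ^ (-(p - 1)) ∂μ) * (∫⁻ t, u t ∂μ) ^ (p - 1) := by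
  have hp0 : 0 < p := by linarith
  have hs : 0 < p - 1 := by linarith
  have hc : p.HolderConjugate (p / (p - 1)) := Real.HolderConjugate.conjExponent hp
  have key := ENNReal.lintegral_mul_le_Lp_mul_Lq μ hc
    (hh.mul (hu.pow_const (-((p - 1) / p)))) (hu.pow_const ((p - 1) / p))
  have e1 : ∫⁻ t, ((h * fun t => u t ^ (-((p - 1) / p))) * fun t => u t ^ ((p - 1) / p)) t ∂μ
      = ∫⁻ t, h t ∂μ := by
    refine lintegral_congr_ae ?_
    filter_upwards [hu0, hu1] with t h0 h1
    simp only [Pi.mul_apply]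
    rw [mul_assoc, ← ENNReal.rpow_add _ _ h0 h1, neg_add_cancel, ENNReal.rpow_zero, mul_one]
  have e2 : ∀ t, ((h * fun t => u t ^ (-((p - 1) / p))) t) ^ p
      = h t ^ p * u t ^ (-(p - 1)) := by
    intro t
    simp only [Pi.mul_apply]
    rw [ENNReal.mul_rpow_of_nonneg _ _ hp0.le, ← ENNReal.rpow_mul]
    congr 2
    field_simp
  have e3 : ∀ t, (u t ^ ((p - 1) / p)) ^ (p / (p - 1)) = u t := by
    intro t
    rw [← ENNReal.rpow_mul]
    have : (p - 1) / p * (p / (p - 1)) = 1 := by field_simp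
    rw [this, ENNReal.rpow_one]
  rw [e1] at key
  simp only [e2, e3] at key
  refine (ENNReal.rpow_le_rpow key hp0.le).trans_eq ?_
  rw [ENNReal.mul_rpow_of_nonneg _ _ hp0.le, ← ENNReal.rpow_mul, ← ENNReal.rpow_mul]
  have e4 : 1 / p * p = 1 := by field_simp
  have e5 : 1 / (p / (p - 1)) * p = p - 1 := by field_simp
  rw [e4, e5, ENNReal.rpow_one]

theorem measurableSet_box {m : ℕ} (x : Fin m → ℝ) : MeasurableSet (box x) :=
  MeasurableSet.univ_pi fun _ => measurableSet_Ioc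

theorem box_subset_orthant {m : ℕ} (x : Fin m → ℝ) : box x ⊆ orthant m :=
  fun _ ht i => (ht i (mem_univ i)).1.le

theorem volume_box {m : ℕ} (x : Fin m → ℝ) : volume (box x) = ∏ i, ENNReal.ofReal (x i) := by
  rw [box, volume_pi_pi]
  simp [Real.volume_Ioc]

theorem lintegral_box_prod_rpow {m : ℕ} {x : ℝ} (hx : 0 < x) :
    ∫⁻ t in box (fun _ : Fin m => x), ENNReal.ofReal (∏ i, t i ^ (-(1 / 2) : ℝ)) =
      ENNReal.ofReal ((2 * x ^ (1 / 2 : ℝ)) ^ m) := by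
  have hint : IntegrableOn (fun s : ℝ => s ^ (-(1 / 2) : ℝ)) (Ioc 0 x) :=
    (intervalIntegrable_iff_integrableOn_Ioc_of_le hx.le).1
      (intervalIntegral.intervalIntegrable_rpow' (by norm_num))
  have hval : ∫ s in Ioc 0 x, s ^ (-(1 / 2) : ℝ) = 2 * x ^ (1 / 2 : ℝ) := by
    rw [← intervalIntegral.integral_of_le hx.le, integral_rpow (Or.inl (by norm_num)),
      Real.zero_rpow (by norm_num)]
    norm_num
    ring
  have hm : (volume : Measure (Fin m → ℝ)).restrict (box fun _ => x) =
      Measure.pi fun _ => volume.restrict (Ioc 0 x) := by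
    rw [box, volume_pi, Measure.restrict_pi_pi]
  rw [← ofReal_integral_eq_lintegral_ofReal]
  · rw [hm, integral_fintype_prod_eq_prod (fun _ s => s ^ (-(1 / 2) : ℝ)), hval]
    simp
  · rw [hm]
    exact Integrable.fintype_prod fun _ => hint
  · refine (ae_restrict_iff' (measurableSet_box _)).2 (Filter.Eventually.of_forall fun t ht => ?_)
    exact Finset.prod_nonneg fun i _ => Real.rpow_nonneg (ht i (mem_univ i)).1.le _

theorem lintegral_box_rpow_le {m : ℕ} {p : ℝ} (hp : 1 < p) {h : (Fin m → ℝ) → ℝ≥0∞}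
    (hh : Measurable h) {x : ℝ} (hx : 0 < x) :
    (∫⁻ t in box (fun _ : Fin m => x), h t) ^ p ≤
      (∫⁻ t in orthant m, h t ^ p) * ENNReal.ofReal (x ^ (m * (p - 1))) := by
  refine (lintegral_rpow_le_weighted (u := fun _ => 1) hp hh.aemeasurable aemeasurable_const
    (by simp) (by simp)).trans ?_
  simp only [ENNReal.one_rpow, mul_one, lintegral_const, one_mul, Measure.restrict_apply_univ]
  refine mul_le_mul' (lintegral_mono_set (box_subset_orthant _)) (le_of_eq ?_)
  rw [volume_box, Finset.prod_const, Finset.card_univ, Fintype.card_fin,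
    ← ENNReal.ofReal_pow hx.le, ENNReal.ofReal_rpow_of_pos (by positivity),
    ← Real.rpow_natCast, ← Real.rpow_mul hx.le]

/-- The exponent -1/2 is a choice: anything in (-1, 0) is integrable at 0 and leaves a positive
power of each t_i. -/
theorem lintegral_box_rpow_le_weighted {m : ℕ} {p : ℝ} (hp : 1 < p) {h : (Fin m → ℝ) → ℝ≥0∞}
    (hh : Measurable h) {x : ℝ} (hx : 0 < x) :
    (∫⁻ t in box (fun _ : Fin m => x), h t) ^ p ≤
      (∫⁻ t in box (fun _ : Fin m => x),
          h t ^ p * ENNReal.ofReal (∏ i, t i ^ ((p - 1) / 2))) *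
        ENNReal.ofReal (2 ^ (m * (p - 1)) * x ^ (m * (p - 1) / 2)) := by
  have hpos : ∀ t ∈ box (fun _ : Fin m => x), 0 < ∏ i, t i ^ (-(1 / 2) : ℝ) := fun t ht =>
    Finset.prod_pos fun i _ => Real.rpow_pos_of_pos (ht i (mem_univ i)).1 _
  refine (lintegral_rpow_le_weighted
    (u := fun t => ENNReal.ofReal (∏ i, t i ^ (-(1 / 2) : ℝ))) hp hh.aemeasurable
    (Measurable.aemeasurable (by fun_prop)) ?_ (by simp)).trans_eq ?_
  · refine (ae_restrict_iff' (measurableSet_box _)).2 (Filter.Eventually.of_forall fun t ht => ?_)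
    simpa using hpos t ht
  · rw [lintegral_box_prod_rpow hx]
    congr 1
    · refine setLIntegral_congr_fun (measurableSet_box _) fun t ht => ?_
      have ht0 : ∀ i, 0 ≤ t i := fun i => (ht i (mem_univ i)).1.le
      rw [ENNReal.ofReal_rpow_of_pos (hpos t ht),
        ← Real.finsetProd_rpow _ _ fun i _ => Real.rpow_nonneg (ht0 i) _]
      congr 2
      refine Finset.prod_congr rfl fun i _ => ?_
      rw [← Real.rpow_mul (ht0 i)]
      congr 1
      ring
    · rw [ENNReal.ofReal_rpow_of_pos (by positivity), ← Real.rpow_natCast,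
        ← Real.rpow_mul (by positivity), Real.mul_rpow (by norm_num) (by positivity),
        ← Real.rpow_mul hx.le]
      congr 3
      ring

/-! ### Tonelli over the growing boxes -/

theorem measurableSet_setOf_mem_box (m : ℕ) :
    MeasurableSet {z : ℝ × (Fin m → ℝ) | z.2 ∈ box fun _ => z.1} := by
  have : {z : ℝ × (Fin m → ℝ) | z.2 ∈ box fun _ => z.1} =
      ⋂ i, ({z | 0 < z.2 i} ∩ {z | z.2 i ≤ z.1}) := by
    ext z
    simp [box]
  rw [this]
  exact MeasurableSet.iInter fun i =>
    (measurableSet_lt (by fun_prop) (by fun_prop)).inter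
      (measurableSet_le (by fun_prop) (by fun_prop))

theorem lintegral_Ioi_rpow {a c : ℝ} (ha : 0 < a) (hc : 0 < c) :
    ∫⁻ x in Ioi c, ENNReal.ofReal (x ^ (-1 - a)) = ENNReal.ofReal (c ^ (-a) / a) := by
  rw [← ofReal_integral_eq_lintegral_ofReal
    (integrableOn_Ioi_rpow_of_lt (by linarith) hc), integral_Ioi_rpow_of_lt (by linarith) hc]
  · congr 1
    rw [show -1 - a + 1 = -a by ring, neg_div_neg_eq]
  · refine (ae_restrict_iff' measurableSet_Ioi).2 (Filter.Eventually.of_forall fun x hx => ?_)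
    exact Real.rpow_nonneg (hc.le.trans (le_of_lt hx)) _

/-- After swapping the integrals, t lies in the box of side x only for x ≥ M = max t_i. The tail
integral M^(-ms)/(ms) absorbs ∏ t_i^s ≤ M^(ms). -/
theorem lintegral_Ioi_rpow_mul_lintegral_box_le {m : ℕ} (hm : 1 ≤ m) {s : ℝ} (hs : 0 < s)
    {g : (Fin m → ℝ) → ℝ≥0∞} (hg : Measurable g) :
    ∫⁻ x in Ioi (0 : ℝ), ENNReal.ofReal (x ^ (-1 - m * s)) *
        ∫⁻ t in box (fun _ : Fin m => x), g t * ENNReal.ofReal (∏ i, t i ^ s) ≤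
      ENNReal.ofReal (1 / (m * s)) * ∫⁻ t in orthant m, g t := by
  have hm0 : (0 : ℝ) < m := by exact_mod_cast hm
  set a : ℝ := m * s with ha
  have ha0 : 0 < a := by positivity
  have hG : Measurable fun t : Fin m → ℝ => g t * ENNReal.ofReal (∏ i, t i ^ s) := by fun_prop
  have hO : MeasurableSet (orthant m) := by
    have : orthant m = ⋂ i, {x | 0 ≤ x i} := by ext; simp [orthant]
    rw [this]
    exact MeasurableSet.iInter fun i => measurableSet_le measurable_const (measurable_pi_apply i)
  have e : ∀ x : ℝ, ENNReal.ofReal (x ^ (-1 - a)) *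
      ∫⁻ t in box (fun _ : Fin m => x), g t * ENNReal.ofReal (∏ i, t i ^ s) =
      ∫⁻ t, ENNReal.ofReal (x ^ (-1 - a)) *
        (box fun _ : Fin m => x).indicator
          (fun t => g t * ENNReal.ofReal (∏ i, t i ^ s)) t := by
    intro x
    rw [lintegral_const_mul _ (hG.indicator (measurableSet_box _)),
      lintegral_indicator (measurableSet_box _)]
  simp only [e]
  rw [lintegral_lintegral_swap, ← lintegral_const_mul _ hg, ← lintegral_indicator hO]
  · refine lintegral_mono fun t => ?_
    by_cases ht : ∀ i, 0 < t i
    · have : Nonempty (Fin m) := ⟨⟨0, hm⟩⟩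
      obtain ⟨i, hi⟩ := Finite.exists_max t
      rw [indicator_of_mem (show t ∈ orthant m from fun i => (ht i).le)]
      have hprod : ∏ j, t j ^ s ≤ t i ^ a := by
        calc ∏ j, t j ^ s ≤ ∏ _j : Fin m, t i ^ s :=
              Finset.prod_le_prod (fun j _ => Real.rpow_nonneg (ht j).le _)
                fun j _ => Real.rpow_le_rpow (ht j).le (hi j) hs.le
          _ = t i ^ a := by
              rw [Finset.prod_const, Finset.card_univ, Fintype.card_fin, ← Real.rpow_natCast,
                ← Real.rpow_mul (ht i).le, mul_comm]
      calc ∫⁻ x in Ioi (0 : ℝ), ENNReal.ofReal (x ^ (-1 - a)) *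
            (box fun _ : Fin m => x).indicator
              (fun t => g t * ENNReal.ofReal (∏ i, t i ^ s)) t
          ≤ ∫⁻ x, (Ici (t i)).indicator (fun x => ENNReal.ofReal (x ^ (-1 - a)) *
              (g t * ENNReal.ofReal (t i ^ a))) x := by
            refine (setLIntegral_le_lintegral _ _).trans (lintegral_mono fun x => ?_)
            by_cases hx : t ∈ box fun _ => x
            · rw [indicator_of_mem hx, indicator_of_mem (show x ∈ Ici (t i) from
                (hx i (mem_univ i)).2)]
              gcongr
            · rw [indicator_of_notMem hx, mul_zero]
              exact zero_le
        _ = ENNReal.ofReal (t i ^ (-a) / a) * (g t * ENNReal.ofReal (t i ^ a)) := by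
            rw [lintegral_indicator measurableSet_Ici, setLIntegral_congr Ioi_ae_eq_Ici.symm,
              lintegral_mul_const _ (by fun_prop), lintegral_Ioi_rpow ha0 (ht i)]
        _ = ENNReal.ofReal (1 / a) * g t := by
            rw [mul_left_comm, ← ENNReal.ofReal_mul (by have := ht i; positivity), mul_comm]
            congr 2
            rw [Real.rpow_neg (ht i).le]
            have := Real.rpow_pos_of_pos (ht i) a
            field_simp
    -- A point with a nonpositive coordinate lies in no box.
    · have : ∀ x : ℝ, t ∉ box fun _ => x := fun x hx => ht fun i => (hx i (mem_univ i)).1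
      simp [this]
  · refine Measurable.aemeasurable ?_
    have : (Function.uncurry fun (x : ℝ) (t : Fin m → ℝ) => ENNReal.ofReal (x ^ (-1 - a)) *
        (box fun _ : Fin m => x).indicator
          (fun t => g t * ENNReal.ofReal (∏ i, t i ^ s)) t) =
        fun z => ENNReal.ofReal (z.1 ^ (-1 - a)) *
          {z : ℝ × (Fin m → ℝ) | z.2 ∈ box fun _ => z.1}.indicator
            (fun z => g z.2 * ENNReal.ofReal (∏ i, z.2 i ^ s)) z := by
      ext z
      rfl
    rw [this]
    exact (by fun_prop : Measurable fun z : ℝ × (Fin m → ℝ) =>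
      ENNReal.ofReal (z.1 ^ (-1 - a))).mul
        ((hG.comp measurable_snd).indicator (measurableSet_setOf_mem_box m))

/-! ### The weighted estimate for box integrals -/

theorem lintegral_weighted_box_rpow_le {m : ℕ} (hm : 1 ≤ m) {p q : ℝ} (hp : 1 < p) (hpq : p ≤ q)
    {h : (Fin m → ℝ) → ℝ≥0∞} (hh : Measurable h) :
    ∫⁻ x in Ioi (0 : ℝ), (ENNReal.ofReal (x ^ (m / p - 1 / q - m)) *
        ∫⁻ t in box (fun _ : Fin m => x), h t) ^ q ≤
      ENNReal.ofReal (2 ^ (m * (p - 1)) * (1 / (m * ((p - 1) / 2)))) *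
        (∫⁻ t in orthant m, h t ^ p) ^ (q / p) := by
  have hp0 : 0 < p := by linarith
  have hq0 : 0 < q := by linarith
  have hs : 0 < (p - 1) / 2 := by linarith
  set A := ∫⁻ t in orthant m, h t ^ p with hA
  have pt : ∀ x ∈ Ioi (0 : ℝ), (ENNReal.ofReal (x ^ (m / p - 1 / q - m)) *
        ∫⁻ t in box (fun _ : Fin m => x), h t) ^ q ≤
      A ^ ((q - p) / p) * ENNReal.ofReal (2 ^ (m * (p - 1))) *
        (ENNReal.ofReal (x ^ (-1 - m * ((p - 1) / 2))) *
          ∫⁻ t in box (fun _ : Fin m => x),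
            h t ^ p * ENNReal.ofReal (∏ i, t i ^ ((p - 1) / 2))) := by
    intro x hx
    have hx : 0 < x := hx
    set F := ∫⁻ t in box (fun _ : Fin m => x), h t
    set W := ∫⁻ t in box (fun _ : Fin m => x),
            h t ^ p * ENNReal.ofReal (∏ i, t i ^ ((p - 1) / 2))
    have h1 : F ^ p ≤ W * ENNReal.ofReal (2 ^ (m * (p - 1)) * x ^ (m * (p - 1) / 2)) :=
      lintegral_box_rpow_le_weighted hp hh hx
    have h2 : F ^ (q - p) ≤ A ^ ((q - p) / p) *
        ENNReal.ofReal (x ^ (m * (p - 1) * ((q - p) / p))) := by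
      have hr : 0 ≤ (q - p) / p := div_nonneg (by linarith) hp0.le
      have := ENNReal.rpow_le_rpow (lintegral_box_rpow_le hp hh hx) hr
      rw [← ENNReal.rpow_mul, mul_div_cancel₀ _ hp0.ne', ENNReal.mul_rpow_of_nonneg _ _ hr,
        ENNReal.ofReal_rpow_of_pos (by positivity), ← Real.rpow_mul hx.le] at this
      exact this
    have hF : F ^ q = F ^ p * F ^ (q - p) := by
      rw [← ENNReal.rpow_add_of_nonneg _ _ hp0.le (by linarith)]
      congr 1
      ring
    -- The value of γ enters here: it makes the powers of x add up to the exponent that Tonelli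
    -- needs.
    have he : (m / p - 1 / q - m) * q + m * (p - 1) / 2 + m * (p - 1) * ((q - p) / p) =
        -1 - m * ((p - 1) / 2) := by
      field_simp
      ring
    rw [ENNReal.mul_rpow_of_nonneg _ _ hq0.le, ENNReal.ofReal_rpow_of_pos (by positivity),
      ← Real.rpow_mul hx.le, hF]
    calc _ ≤ ENNReal.ofReal (x ^ ((m / p - 1 / q - m) * q)) *
          ((W * ENNReal.ofReal (2 ^ (m * (p - 1)) * x ^ (m * (p - 1) / 2))) *
          (A ^ ((q - p) / p) * ENNReal.ofReal (x ^ (m * (p - 1) * ((q - p) / p))))) := by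
          gcongr
      _ = A ^ ((q - p) / p) * ENNReal.ofReal (2 ^ (m * (p - 1))) *
          ((ENNReal.ofReal (x ^ ((m / p - 1 / q - m) * q)) *
            ENNReal.ofReal (x ^ (m * (p - 1) / 2)) *
            ENNReal.ofReal (x ^ (m * (p - 1) * ((q - p) / p)))) * W) := by
          rw [ENNReal.ofReal_mul (by positivity)]
          ring
      _ = _ := by
          rw [← ENNReal.ofReal_mul (by positivity), ← ENNReal.ofReal_mul (by positivity),
            ← Real.rpow_add hx, ← Real.rpow_add hx, he, mul_assoc]
  have hle := lintegral_Ioi_rpow_mul_lintegral_box_le hm hs (hh.pow_const p)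
  have hms : Measurable fun x : ℝ => ENNReal.ofReal (x ^ (-1 - m * ((p - 1) / 2))) *
      ∫⁻ t in box (fun _ : Fin m => x),
        h t ^ p * ENNReal.ofReal (∏ i, t i ^ ((p - 1) / 2)) := by
    refine Measurable.mul (by fun_prop) ?_
    simp only [← lintegral_indicator (measurableSet_box _)]
    refine Measurable.lintegral_prod_right' (f := fun z : ℝ × (Fin m → ℝ) =>
      {z : ℝ × (Fin m → ℝ) | z.2 ∈ box fun _ => z.1}.indicator
        (fun z => h z.2 ^ p * ENNReal.ofReal (∏ i, z.2 i ^ ((p - 1) / 2))) z) ?_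
    exact Measurable.indicator (f := fun z : ℝ × (Fin m → ℝ) =>
      h z.2 ^ p * ENNReal.ofReal (∏ i, z.2 i ^ ((p - 1) / 2))) (by fun_prop)
      (measurableSet_setOf_mem_box m)
  calc _ ≤ _ := setLIntegral_mono' measurableSet_Ioi pt
    _ = _ := lintegral_const_mul _ hms
    _ ≤ _ := mul_le_mul_right hle _
    _ = ENNReal.ofReal (2 ^ (m * (p - 1))) * ENNReal.ofReal (1 / (m * ((p - 1) / 2))) *
          (A ^ ((q - p) / p) * A ^ (1 : ℝ)) := by
        rw [ENNReal.rpow_one]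
        ring
    _ = _ := by
        rw [← ENNReal.rpow_add_of_nonneg _ _ (div_nonneg (by linarith) hp0.le) zero_le_one,
          ← ENNReal.ofReal_mul (by positivity)]
        congr 2
        field_simp
        ring

/-! ### Transfer to the diagonal trace -/

theorem stronglyMeasurable_diagTrace {m : ℕ} (γ : ℝ) {H : (Fin m → ℝ) → ℂ}
    (hH : StronglyMeasurable H) : StronglyMeasurable (diagTrace γ H) := by
  unfold diagTrace tensorHardy
  have : StronglyMeasurable fun x : ℝ => ∫ t in box (fun _ : Fin m => x), H t := by
    simp only [← integral_indicator (measurableSet_box _)]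
    refine StronglyMeasurable.integral_prod_right' (f := fun z : ℝ × (Fin m → ℝ) =>
      {z : ℝ × (Fin m → ℝ) | z.2 ∈ box fun _ => z.1}.indicator (fun z => H z.2) z) ?_
    exact (hH.comp_measurable measurable_snd).indicator (measurableSet_setOf_mem_box m)
  have hγ : Measurable fun x : ℝ => x ^ γ := by fun_prop
  have hm : Measurable fun x : ℝ => (∏ _i : Fin m, x)⁻¹ := by fun_prop
  exact hγ.stronglyMeasurable.smul (hm.stronglyMeasurable.smul this)

theorem enorm_diagTrace_le {m : ℕ} (γ : ℝ) (H : (Fin m → ℝ) → ℂ) {x : ℝ} (hx : 0 < x) :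
    ‖diagTrace γ H x‖ₑ ≤
      ENNReal.ofReal (x ^ (γ - m)) * ∫⁻ t in box (fun _ : Fin m => x), ‖H t‖ₑ := by
  have e : diagTrace γ H x = (x ^ (γ - m) : ℝ) • ∫ t in box (fun _ : Fin m => x), H t := by
    rw [diagTrace, tensorHardy, smul_smul, Finset.prod_const, Finset.card_univ, Fintype.card_fin,
      Real.rpow_sub hx, Real.rpow_natCast, div_eq_mul_inv]
  rw [e, enorm_smul, Real.enorm_of_nonneg (by positivity)]
  gcongr
  exact enorm_integral_le_lintegral_enorm _

theorem eLpNorm_diagTrace_le {m : ℕ} (hm : 1 ≤ m) {p q : ℝ} (hp : 1 < p) (hpq : p ≤ q)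
    {H : (Fin m → ℝ) → ℂ} (hH : StronglyMeasurable H) :
    eLpNorm (diagTrace (m / p - 1 / q) H) (ENNReal.ofReal q) (volume.restrict (Ioi 0)) ≤
      ENNReal.ofReal (2 ^ (m * (p - 1)) * (1 / (m * ((p - 1) / 2)))) ^ (1 / q) *
        eLpNorm H (ENNReal.ofReal p) (volume.restrict (orthant m)) := by
  have hp0 : 0 < p := by linarith
  have hq0 : 0 < q := by linarith
  rw [eLpNorm_eq_lintegral_rpow_enorm_toReal (by simpa using hq0) ENNReal.ofReal_ne_top,
    eLpNorm_eq_lintegral_rpow_enorm_toReal (by simpa using hp0) ENNReal.ofReal_ne_top,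
    ENNReal.toReal_ofReal hq0.le, ENNReal.toReal_ofReal hp0.le]
  have h1 := (setLIntegral_mono' measurableSet_Ioi fun x hx =>
    ENNReal.rpow_le_rpow (enorm_diagTrace_le (m / p - 1 / q) H hx) hq0.le).trans
      (lintegral_weighted_box_rpow_le hm hp hpq hH.enorm)
  refine (ENNReal.rpow_le_rpow h1 (by positivity : 0 ≤ 1 / q)).trans_eq ?_
  rw [ENNReal.mul_rpow_of_nonneg _ _ (by positivity), ← ENNReal.rpow_mul]
  congr 2
  field_simp

/-- Equality holds at every x, since only integrals over boxes inside the orthant enter; so H may be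
replaced by a strongly measurable representative. -/
theorem diagTrace_congr_ae {m : ℕ} (γ : ℝ) {H H' : (Fin m → ℝ) → ℂ}
    (h : H =ᵐ[volume.restrict (orthant m)] H') : diagTrace γ H = diagTrace γ H' := by
  ext x
  have := integral_congr_ae
    (ae_restrict_of_ae_restrict_of_subset (box_subset_orthant fun _ : Fin m => x) h)
  simp only [diagTrace, tensorHardy, this]

theorem integrableOn_box_of_memLp {m : ℕ} {p : ℝ≥0∞} (hp : 1 ≤ p) {H : (Fin m → ℝ) → ℂ}
    (hH : MemLp H p (volume.restrict (orthant m))) (x : Fin m → ℝ) : IntegrableOn H (box x) := by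
  have : IsFiniteMeasure (volume.restrict (box x)) := by
    refine isFiniteMeasure_restrict.2 ?_
    rw [volume_box]
    exact ENNReal.prod_ne_top fun _ _ => ENNReal.ofReal_ne_top
  exact (hH.mono_measure (Measure.restrict_mono (box_subset_orthant x) le_rfl)).integrable hp

theorem mainTheorem9 (m : ℕ) (hm : 1 ≤ m) (p q γ : ℝ) (hp : 1 < p) (hpq : p ≤ q)
    (hγ : γ = m / p - 1 / q) :
    ∃ C : ℝ≥0, ∀ H : (Fin m → ℝ) → ℂ,
      MemLp H (ENNReal.ofReal p) (volume.restrict (orthant m)) →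
        (∀ x : Fin m → ℝ, IntegrableOn H (box x)) ∧
        MemLp (diagTrace γ H) (ENNReal.ofReal q) (volume.restrict (Ioi 0)) ∧
        eLpNorm (diagTrace γ H) (ENNReal.ofReal q) (volume.restrict (Ioi 0)) ≤
          C * eLpNorm H (ENNReal.ofReal p) (volume.restrict (orthant m)) := by
  subst hγ
  refine ⟨(ENNReal.ofReal (2 ^ (m * (p - 1)) * (1 / (m * ((p - 1) / 2)))) ^ (1 / q)).toNNReal,
    fun H hH => ?_⟩
  rw [ENNReal.coe_toNNReal (ENNReal.rpow_ne_top_of_nonneg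
    (one_div_nonneg.2 (by linarith)) ENNReal.ofReal_ne_top)]
  have hae := hH.1.ae_eq_mk
  have hle := eLpNorm_diagTrace_le hm hp hpq hH.1.stronglyMeasurable_mk
  rw [← diagTrace_congr_ae _ hae, ← eLpNorm_congr_ae hae] at hle
  refine ⟨integrableOn_box_of_memLp (by simpa using hp.le) hH, ⟨?_, ?_⟩, hle⟩
  · rw [diagTrace_congr_ae _ hae]
    exact (stronglyMeasurable_diagTrace _ hH.1.stronglyMeasurable_mk).aestronglyMeasurable
  · exact hle.trans_lt (ENNReal.mul_lt_top (ENNReal.rpow_lt_top_of_nonneg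
      (one_div_nonneg.2 (by linarith)) ENNReal.ofReal_ne_top) hH.2)
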